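/- **Language.** Fix two disjoint countably infinite sets of variables, object variables $p$ and property variables $P$. Formulae are given by $$\alpha ::= \top\mid\bot\mid p\mid P\mid \alpha\sqcup\beta\mid\alpha\sqcap\beta\mid\neg\alpha\mid\lrcorner\alpha\mid\square\alpha\mid\blacksquare\alpha ,$$ with $\alpha\vee\beta:=\neg(\neg\alpha\sqcap\neg\beta)$ and $\alpha\wedge\beta:=\lrcorner(\lrcorner\alpha\sqcup\lrcorner\beta)$. A sequent $\alpha\vdash\beta$ is a pair of formulae; an s-hypersequent is a (possibly empty) finite sequence $\alpha_1\vdash\beta_1\mid\dots\mid\alpha_n\vdash\beta_n$ of sequents. **The calculus MPDBL.** Axioms ($\dashv\vdash$ stands for both sequents): $\alpha\vdash\alpha$; $\ \alpha\sqcap\beta\vdash\alpha$; $\ \alpha\sqcap\beta\vdash\beta$; $\ \alpha\sqcap\beta\vdash(\alpha\sqcap\beta)\sqcap(\alpha\sqcap\beta)$; $\ \alpha\vdash\alpha\sqcup\beta$; $\ \beta\vdash\alpha\sqcup\beta$; $\ (\alpha\sqcup\beta)\sqcup(\alpha\sqcup\beta)\vdash\alpha\sqcup\beta$; $\ \neg(\alpha\sqcap\alpha)\vdash\neg\alpha$;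 $\ \lrcorner\alpha\vdash\lrcorner(\alpha\sqcup\alpha)$; $\ \alpha\sqcap\neg\alpha\vdash\bot$; $\ \top\vdash\alpha\sqcup\lrcorner\alpha$; $\ \neg\neg(\alpha\sqcap\beta)\dashv\vdash\alpha\sqcap\beta$; $\ \lrcorner\lrcorner(\alpha\sqcup\beta)\dashv\vdash\alpha\sqcup\beta$; $\ \alpha\sqcap\alpha\vdash\alpha\sqcap(\alpha\sqcup\beta)$; $\ \alpha\sqcup(\alpha\sqcap\beta)\vdash\alpha\sqcup\alpha$; $\ \alpha\sqcap\alpha\vdash\alpha\sqcap(\alpha\vee\beta)$; $\ \alpha\sqcup(\alpha\wedge\beta)\vdash\alpha\sqcup\alpha$; $\ \alpha\sqcap(\beta\vee\gamma)\dashv\vdash(\alpha\sqcap\beta)\vee(\alpha\sqcap\gamma)$; $\ \alpha\sqcup(\beta\wedge\gamma)\dashv\vdash(\alpha\sqcup\beta)\wedge(\alpha\sqcup\gamma)$; $\ \bot\vdash\alpha$; $\ \alpha\vdash\top$; $\ \neg\top\vdash\bot$; $\ \top\vdash\lrcorner\bot$; $\ \neg\bot\dashv\vdash\top\sqcap\top$;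 $\ \lrcorner\top\dashv\vdash\bot\sqcup\bot$; $\ (\alpha\sqcup\alpha)\sqcap(\alpha\sqcup\alpha)\dashv\vdash(\alpha\sqcap\alpha)\sqcup(\alpha\sqcap\alpha)$; $\ p\sqcap p\dashv\vdash p$; $\ P\sqcup P\dashv\vdash P$; $\ \square\alpha\sqcap\square\beta\dashv\vdash\square(\alpha\sqcap\beta)$; $\ \blacksquare\alpha\sqcup\blacksquare\beta\dashv\vdash\blacksquare(\alpha\sqcup\beta)$; $\ \square\neg\bot\dashv\vdash\neg\bot$; $\ \blacksquare\lrcorner\top\dashv\vdash\lrcorner\top$; $\ \square(\alpha\sqcap\alpha)\dashv\vdash\square\alpha$; $\ \blacksquare(\alpha\sqcup\alpha)\dashv\vdash\blacksquare\alpha$. Rules ($B,C,\dots$ are possibly empty s-hypersequents): - from $B\mid\alpha\vdash\beta\mid C$ infer $B\mid\sigma\mid C$, where $\sigma$ is any of $\alpha\sqcap\gamma\vdash\beta\sqcap\gamma$, $\ \gamma\sqcap\alpha\vdash\gamma\sqcap\beta$, $\ \alpha\sqcup\gamma\vdash\beta\sqcup\gamma$, $\ \gamma\sqcup\alpha\vdash\gamma\sqcup\beta$,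 $\ \neg\beta\vdash\neg\alpha$, $\ \lrcorner\beta\vdash\lrcorner\alpha$, $\ \square\alpha\vdash\square\beta$, $\ \blacksquare\alpha\vdash\blacksquare\beta$; - from $B\mid\alpha\vdash\beta\mid C$ and $D\mid\beta\vdash\gamma\mid E$ infer $B\mid D\mid\alpha\vdash\gamma\mid C\mid E$; - without premises infer $\alpha\vdash\alpha\sqcap\alpha\mid\alpha\sqcup\alpha\vdash\alpha$; - from $B\mid\alpha\sqcap\beta\vdash\alpha\sqcap\alpha\mid C$, $\ D\mid\alpha\sqcap\alpha\vdash\alpha\sqcap\beta\mid E$, $\ F\mid\alpha\sqcup\beta\vdash\beta\sqcup\beta\mid G$ and $H\mid\beta\sqcup\beta\vdash\alpha\sqcup\beta\mid X$ infer $B\mid D\mid F\mid H\mid\alpha\vdash\beta\mid C\mid E\mid G\mid X$; - from $B\mid D\mid D\mid C$ infer $B\mid D\mid C$; from $B\mid D\mid E\mid C$ infer $B\mid E\mid D\mid C$; from $B$ infer $B\mid C$. An s-hypersequent is provable if it is the last member of a finite sequence of s-hypersequents each of which is an axiom or follows from earlier members by a rule. **Semantics.** A Kripke context $\mathbb{KC}=((G,R),(M,S),I)$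 consists of sets $G$, $M$ and binary relations $R\subseteq G\times G$, $S\subseteq M\times M$, $I\subseteq G\times M$. For $A\subseteq G$, $B\subseteq M$ put $A'=\{m:\forall g\in A,\ gIm\}$ and $B'=\{g:\forall m\in B,\ gIm\}$; a pair $(A,B)$ is a semiconcept if $A'=B$ or $B'=A$. For a relation $E$ on $W$ and $A\subseteq W$, the lower approximation is $\underline{A}_E=\{x:\forall y\,(xEy\Rightarrow y\in A)\}$. A model is a Kripke context with a valuation $v$ sending every object variable to a semiconcept of the form $(A,A')$ and every property variable to one of the form $(B',B)$. Satisfaction $g\models\alpha$ ($g\in G$) and co-satisfaction $m\succ\alpha$ ($m\in M$) are defined by recursion; with $v_1(\alpha)=\{g:g\models\alpha\}$, $v_2(\alpha)=\{m:m\succ\alpha\}$: - $(v_1(x),v_2(x))=v(x)$ for variables $x$; $\ v_1(\top)=G$, $v_2(\top)=\emptyset$; $\ v_1(\bot)=\emptyset$, $v_2(\bot)=M$; - $g\models\alpha\sqcap\beta$ iff $g\models\alpha$ and $g\models\beta$; $\ g\models\neg\alpha$ iff $g\not\models\alpha$; $\ g\models\square\alpha$ iff $g_1\models\alpha$ for all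 $g_1$ with $gRg_1$; and for $\delta$ of the form $\alpha\sqcap\beta$, $\neg\alpha$ or $\square\alpha$: $m\succ\delta$ iff $gIm$ for all $g$ with $g\models\delta$; - $m\succ\alpha\sqcup\beta$ iff $m\succ\alpha$ and $m\succ\beta$; $\ m\succ\lrcorner\alpha$ iff $m\not\succ\alpha$; $\ m\succ\blacksquare\alpha$ iff $m_1\succ\alpha$ for all $m_1$ with $mSm_1$; and for $\delta$ of the form $\alpha\sqcup\beta$, $\lrcorner\alpha$ or $\blacksquare\alpha$: $g\models\delta$ iff $gIm$ for all $m$ with $m\succ\delta$. A sequent $\alpha\vdash\beta$ is satisfied in a model if $v_1(\alpha)\subseteq v_1(\beta)$ and $v_2(\beta)\subseteq v_2(\alpha)$; an s-hypersequent is satisfied if at least one of its components is; it is valid in the class $\mathcal{KC}$ of all Kripke contexts if it is satisfied in every model based on every Kripke context. **Theorem.** 1. In every model and for every formula $\alpha$, $(v_1(\alpha),v_2(\alpha))$ is a semiconcept. Moreover $v_1(\square\alpha)=\underline{v_1(\alpha)}_R$, $v_2(\square\alpha)=(\underline{v_1(\alpha)}_R)'$, $v_2(\blacksquare\alpha)=\underline{v_2(\alpha)}_S$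 and $v_1(\blacksquare\alpha)=(\underline{v_2(\alpha)}_S)'$. 2. (Soundness) Every s-hypersequent provable in MPDBL is valid in $\mathcal{KC}$. 3. (Completeness) Every s-hypersequent valid in $\mathcal{KC}$ is provable in MPDBL. -/

import Mathlib

universe u v

namespace MPDBL

/-! ### Syntax -/

/-- Formulae over the object variables `ov n` and the property variables `pv n`, `n : ℕ`.
`neg` is `¬`, `opp` is the second negation `⌟`, `box` is `□` and `bbox` is `■`. -/
inductive Formula : Type
  | ov (n : ℕ)
  | pv (n : ℕ)
  | top
  | bot
  | meet (α β : Formula)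
  | join (α β : Formula)
  | neg (α : Formula)
  | opp (α : Formula)
  | box (α : Formula)
  | bbox (α : Formula)

namespace Formula

/-- The defined connective `α ∨ β := ¬(¬α ⊓ ¬β)`. -/
def vee (α β : Formula) : Formula := neg (meet (neg α) (neg β))

/-- The defined connective `α ∧ β := ⌟(⌟α ⊔ ⌟β)`. -/
def wedge (α β : Formula) : Formula := opp (join (opp α) (opp β))

end Formula

/-- A sequent `α ⊢ β` is a pair of formulae. -/
structure Sequent : Type where
  lhs : Formula
  rhs : Formula

infix:50 " ⟹ₛ " => Sequent.mk

/-- An s-hypersequent is a (possibly empty) finite sequence of sequents. -/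
abbrev Hypersequent : Type := List Sequent

open Formula

/-- The axioms of MPDBL.  For each axiom stated with `⊣⊢` there are two constructors,
the second one primed. -/
inductive IsAxiom : Sequent → Prop
  | ax1 (α) : IsAxiom (α ⟹ₛ α)
  | ax2a (α β) : IsAxiom (meet α β ⟹ₛ α)
  | ax2b (α β) : IsAxiom (α ⟹ₛ join α β)
  | ax3a (α β) : IsAxiom (meet α β ⟹ₛ β)
  | ax3b (α β) : IsAxiom (β ⟹ₛ join α β)
  | ax4a (α β) : IsAxiom (meet α β ⟹ₛ meet (meet α β) (meet α β))
  | ax4b (α β) : IsAxiom (join (join α β) (join α β) ⟹ₛ join α β)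
  | ax5a (α) : IsAxiom (neg (meet α α) ⟹ₛ neg α)
  | ax5b (α) : IsAxiom (opp α ⟹ₛ opp (join α α))
  | ax6a (α) : IsAxiom (meet α (neg α) ⟹ₛ bot)
  | ax6b (α) : IsAxiom (top ⟹ₛ join α (opp α))
  | ax7a (α β) : IsAxiom (neg (neg (meet α β)) ⟹ₛ meet α β)
  | ax7a' (α β) : IsAxiom (meet α β ⟹ₛ neg (neg (meet α β)))
  | ax7b (α β) : IsAxiom (opp (opp (join α β)) ⟹ₛ join α β)
  | ax7b' (α β) : IsAxiom (join α β ⟹ₛ opp (opp (join α β)))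
  | ax8a (α β) : IsAxiom (meet α α ⟹ₛ meet α (join α β))
  | ax8b (α β) : IsAxiom (join α (meet α β) ⟹ₛ join α α)
  | ax9a (α β) : IsAxiom (meet α α ⟹ₛ meet α (vee α β))
  | ax9b (α β) : IsAxiom (join α (wedge α β) ⟹ₛ join α α)
  | ax10a (α β γ) : IsAxiom (meet α (vee β γ) ⟹ₛ vee (meet α β) (meet α γ))
  | ax10a' (α β γ) : IsAxiom (vee (meet α β) (meet α γ) ⟹ₛ meet α (vee β γ))
  | ax10b (α β γ) : IsAxiom (join α (wedge β γ) ⟹ₛ wedge (join α β) (join α γ))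
  | ax10b' (α β γ) : IsAxiom (wedge (join α β) (join α γ) ⟹ₛ join α (wedge β γ))
  | ax11a (α) : IsAxiom (bot ⟹ₛ α)
  | ax11b (α) : IsAxiom (α ⟹ₛ top)
  | ax12a : IsAxiom (neg top ⟹ₛ bot)
  | ax12b : IsAxiom (top ⟹ₛ opp bot)
  | ax13a : IsAxiom (neg bot ⟹ₛ meet top top)
  | ax13a' : IsAxiom (meet top top ⟹ₛ neg bot)
  | ax13b : IsAxiom (opp top ⟹ₛ join bot bot)
  | ax13b' : IsAxiom (join bot bot ⟹ₛ opp top)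
  | ax14 (α) : IsAxiom (meet (join α α) (join α α) ⟹ₛ join (meet α α) (meet α α))
  | ax14' (α) : IsAxiom (join (meet α α) (meet α α) ⟹ₛ meet (join α α) (join α α))
  | ax15a (n) : IsAxiom (meet (ov n) (ov n) ⟹ₛ ov n)
  | ax15a' (n) : IsAxiom (ov n ⟹ₛ meet (ov n) (ov n))
  | ax15b (n) : IsAxiom (join (pv n) (pv n) ⟹ₛ pv n)
  | ax15b' (n) : IsAxiom (pv n ⟹ₛ join (pv n) (pv n))
  | ax16a (α β) : IsAxiom (meet (box α) (box β) ⟹ₛ box (meet α β))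
  | ax16a' (α β) : IsAxiom (box (meet α β) ⟹ₛ meet (box α) (box β))
  | ax16b (α β) : IsAxiom (join (bbox α) (bbox β) ⟹ₛ bbox (join α β))
  | ax16b' (α β) : IsAxiom (bbox (join α β) ⟹ₛ join (bbox α) (bbox β))
  | ax17a : IsAxiom (box (neg bot) ⟹ₛ neg bot)
  | ax17a' : IsAxiom (neg bot ⟹ₛ box (neg bot))
  | ax17b : IsAxiom (bbox (opp top) ⟹ₛ opp top)
  | ax17b' : IsAxiom (opp top ⟹ₛ bbox (opp top))
  | ax18a (α) : IsAxiom (box (meet α α) ⟹ₛ box α)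
  | ax18a' (α) : IsAxiom (box α ⟹ₛ box (meet α α))
  | ax18b (α) : IsAxiom (bbox (join α α) ⟹ₛ bbox α)
  | ax18b' (α) : IsAxiom (bbox α ⟹ₛ bbox (join α α))

/-- Provability of s-hypersequents in MPDBL.  All side hypersequents may be empty. -/
inductive Provable : Hypersequent → Prop
  | ax {s : Sequent} : IsAxiom s → Provable [s]
  | r1 {B C : Hypersequent} {α β : Formula} (γ : Formula) :
      Provable (B ++ [α ⟹ₛ β] ++ C) → Provable (B ++ [meet α γ ⟹ₛ meet β γ] ++ C)
  | r1' {B C : Hypersequent} {α β : Formula} (γ : Formula) :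
      Provable (B ++ [α ⟹ₛ β] ++ C) → Provable (B ++ [meet γ α ⟹ₛ meet γ β] ++ C)
  | r2 {B C : Hypersequent} {α β : Formula} (γ : Formula) :
      Provable (B ++ [α ⟹ₛ β] ++ C) → Provable (B ++ [join α γ ⟹ₛ join β γ] ++ C)
  | r2' {B C : Hypersequent} {α β : Formula} (γ : Formula) :
      Provable (B ++ [α ⟹ₛ β] ++ C) → Provable (B ++ [join γ α ⟹ₛ join γ β] ++ C)
  | r3 {B C : Hypersequent} {α β : Formula} :
      Provable (B ++ [α ⟹ₛ β] ++ C) → Provable (B ++ [neg β ⟹ₛ neg α] ++ C)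
  | r3' {B C : Hypersequent} {α β : Formula} :
      Provable (B ++ [α ⟹ₛ β] ++ C) → Provable (B ++ [opp β ⟹ₛ opp α] ++ C)
  | r4 {B C D E : Hypersequent} {α β γ : Formula} :
      Provable (B ++ [α ⟹ₛ β] ++ C) → Provable (D ++ [β ⟹ₛ γ] ++ E) →
      Provable (B ++ D ++ [α ⟹ₛ γ] ++ C ++ E)
  | sp (α : Formula) : Provable [α ⟹ₛ meet α α, join α α ⟹ₛ α]
  | r5 {B C D E F G H X : Hypersequent} {α β : Formula} :
      Provable (B ++ [meet α β ⟹ₛ meet α α] ++ C) →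
      Provable (D ++ [meet α α ⟹ₛ meet α β] ++ E) →
      Provable (F ++ [join α β ⟹ₛ join β β] ++ G) →
      Provable (H ++ [join β β ⟹ₛ join α β] ++ X) →
      Provable (B ++ D ++ F ++ H ++ [α ⟹ₛ β] ++ C ++ E ++ G ++ X)
  | ec {B C D : Hypersequent} : Provable (B ++ D ++ D ++ C) → Provable (B ++ D ++ C)
  | ee {B C D E : Hypersequent} : Provable (B ++ D ++ E ++ C) → Provable (B ++ E ++ D ++ C)
  | ew {B : Hypersequent} (C : Hypersequent) : Provable B → Provable (B ++ C)
  | r8 {B C : Hypersequent} {α β : Formula} :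
      Provable (B ++ [α ⟹ₛ β] ++ C) → Provable (B ++ [box α ⟹ₛ box β] ++ C)
  | r9 {B C : Hypersequent} {α β : Formula} :
      Provable (B ++ [α ⟹ₛ β] ++ C) → Provable (B ++ [bbox α ⟹ₛ bbox β] ++ C)

/-! ### Semiconcepts

A context is given by a set `G` of objects, a set `M` of properties and a relation
`I : G → M → Prop`.  The derivation operators `A ↦ A'` and `B ↦ B'` are Mathlib's
`upperPolar I` and `lowerPolar I`. -/

section Semiconcepts

variable {G : Type u} {M : Type v}

/-- `(A, B)` is a semiconcept if `A' = B` or `B' = A`. -/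
def IsSemiconcept (I : G → M → Prop) (A : Set G) (B : Set M) : Prop :=
  upperPolar I A = B ∨ lowerPolar I B = A

/-- The semiconcepts of the context `(G, M, I)`. -/
@[ext]
structure Semiconcept (I : G → M → Prop) : Type (max u v) where
  extent : Set G
  intent : Set M
  isSemiconcept : IsSemiconcept I extent intent

/-- The operation `⊓` on semiconcepts. -/
def Semiconcept.meet {I : G → M → Prop} (x y : Semiconcept I) : Semiconcept I where
  extent := x.extent ∩ y.extent
  intent := upperPolar I (x.extent ∩ y.extent)
  isSemiconcept := Or.inl rfl

/-- The operation `⊔` on semiconcepts. -/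
def Semiconcept.join {I : G → M → Prop} (x y : Semiconcept I) : Semiconcept I where
  extent := lowerPolar I (x.intent ∩ y.intent)
  intent := x.intent ∩ y.intent
  isSemiconcept := Or.inr rfl

/-- A valuation on the algebra of semiconcepts.  Object variables denote left semiconcepts
(idempotent for `⊓`), property variables right semiconcepts (idempotent for `⊔`); the values
`(G, ∅)` of `⊤` and `(∅, M)` of `⊥` are forced and are built into `Sat` and `CoSat`. -/
structure ContextValuation (I : G → M → Prop) : Type (max u v) where
  ov : ℕ → Semiconcept I
  pv : ℕ → Semiconcept I
  ov_left : ∀ n, (ov n).meet (ov n) = ov n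
  pv_right : ∀ n, (pv n).join (pv n) = pv n

end Semiconcepts

/-! ### Kripke contexts and models -/

/-- A Kripke context `((G, R), (M, S), I)`. -/
structure KripkeContext (G : Type u) (M : Type v) : Type (max u v) where
  R : G → G → Prop
  S : M → M → Prop
  I : G → M → Prop

section Semantics

variable {G : Type u} {M : Type v}

/-- The lower approximation `{x | E(x) ⊆ A}` of `A`, where `E(x) = {y | x E y}`. -/
def lowerApprox {W : Type*} (E : W → W → Prop) (A : Set W) : Set W :=
  {x | {y | E x y} ⊆ A}

mutual

/-- Satisfaction `𝕄, g ⊨ α` in the model `𝕄 = (K, V)`. -/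
def Sat (K : KripkeContext G M) (V : ContextValuation K.I) : Formula → G → Prop
  | .ov n, g => g ∈ (V.ov n).extent
  | .pv n, g => g ∈ (V.pv n).extent
  | .top, _ => True
  | .bot, _ => False
  | .meet α β, g => Sat K V α g ∧ Sat K V β g
  | .join α β, g => ∀ m, (CoSat K V α m ∧ CoSat K V β m) → K.I g m
  | .neg α, g => ¬ Sat K V α g
  | .opp α, g => ∀ m, ¬ CoSat K V α m → K.I g m
  | .box α, g => ∀ g₁, K.R g g₁ → Sat K V α g₁
  | .bbox α, g => ∀ m, (∀ m₁, K.S m m₁ → CoSat K V α m₁) → K.I g m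

/-- Co-satisfaction `𝕄, m ≻ α` in the model `𝕄 = (K, V)`. -/
def CoSat (K : KripkeContext G M) (V : ContextValuation K.I) : Formula → M → Prop
  | .ov n, m => m ∈ (V.ov n).intent
  | .pv n, m => m ∈ (V.pv n).intent
  | .top, _ => False
  | .bot, _ => True
  | .meet α β, m => ∀ g, (Sat K V α g ∧ Sat K V β g) → K.I g m
  | .join α β, m => CoSat K V α m ∧ CoSat K V β m
  | .neg α, m => ∀ g, ¬ Sat K V α g → K.I g m
  | .opp α, m => ¬ CoSat K V α m
  | .box α, m => ∀ g, (∀ g₁, K.R g g₁ → Sat K V α g₁) → K.I g m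
  | .bbox α, m => ∀ m₁, K.S m m₁ → CoSat K V α m₁

end

/-- The extent `v₁(α)` of a formula in a model. -/
def extent (K : KripkeContext G M) (V : ContextValuation K.I) (α : Formula) : Set G :=
  {g | Sat K V α g}

/-- The intent `v₂(α)` of a formula in a model. -/
def intent (K : KripkeContext G M) (V : ContextValuation K.I) (α : Formula) : Set M :=
  {m | CoSat K V α m}

/-- Satisfaction of a sequent in a model. -/
def SatSequent (K : KripkeContext G M) (V : ContextValuation K.I) (s : Sequent) : Prop :=
  (∀ g, Sat K V s.lhs g → Sat K V s.rhs g) ∧ (∀ m, CoSat K V s.rhs m → CoSat K V s.lhs m)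

/-- An s-hypersequent is satisfied in a model if at least one of its components is. -/
def SatHypersequent (K : KripkeContext G M) (V : ContextValuation K.I) (H : Hypersequent) : Prop :=
  ∃ s ∈ H, SatSequent K V s

/-- Truth in a Kripke context. -/
def TrueIn (K : KripkeContext G M) (H : Hypersequent) : Prop :=
  ∀ V : ContextValuation K.I, SatHypersequent K V H

end Semantics

/-- Validity in the class of all Kripke contexts. -/
def Valid (H : Hypersequent) : Prop :=
  ∀ (G : Type u) (M : Type v) (K : KripkeContext G M), TrueIn K H

end MPDBL

namespace MPDBL

open Formula

/-! ### Semiconcepts and soundness -/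

section Soundness

variable {G : Type u} {M : Type v}

-- Soundness is an induction on derivations. Besides unfolding the clauses, it rests on one fact:
-- every formula denotes a left semiconcept (`A' = B`) or a right one (`B' = A`).
--
-- Completeness comes from one canonical model in which every satisfied sequent is already provable
-- as a one-component hypersequent. A valid hypersequent has a component satisfied there, and
-- weakening and exchange restore the other components.
--
-- The formulae carry two structures dual to each other: `⊓, ¬, □` under provability, and `⊔, ⌟, ■`
-- under its converse. Both are instances of `ModalHalf`, so each algebraic fact is proved once.
-- Objects are primary filters, properties are primary ideals (primary filters of the second half),
-- and a filter is incident with an ideal when they intersect.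
--
-- By its outermost symbol, each formula other than `⊤` and `⊥` is provably idempotent for `⊓` or
-- for `⊔`. In the first case membership in filters is computed recursively, and membership in
-- ideals follows by separation (`mem_ideal_iff`); the second case is dual (`mem_filter_iff`). This
-- gives the truth lemma `sat_coSat_canonical`.
--
-- Primary filters and primary ideals yield only `α ⊓ α ⊢ β` and `α ⊢ β ⊔ β`; the rule `r5` combines
-- these into `α ⊢ β`.

theorem isSemiconcept_extent_intent (K : KripkeContext G M) (V : ContextValuation K.I)
    (α : Formula) : IsSemiconcept K.I (extent K V α) (intent K V α) := by
  cases α with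
  | ov n =>
    simp only [extent, intent, Sat, CoSat]
    exact (V.ov n).isSemiconcept
  | pv n =>
    simp only [extent, intent, Sat, CoSat]
    exact (V.pv n).isSemiconcept
  | top => right; ext g; simp [extent, intent, Sat, CoSat, lowerPolar]
  | bot => left; ext m; simp [extent, intent, Sat, CoSat, upperPolar]
  | meet | neg | box => left; ext m; simp [extent, intent, Sat, CoSat, upperPolar]
  | join | opp | bbox => right; ext g; simp [extent, intent, Sat, CoSat, lowerPolar]

/-- A formula denotes a left or a right semiconcept. -/
theorem coSat_iff_or_sat_iff (K : KripkeContext G M) (V : ContextValuation K.I) (α : Formula) :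
    (∀ m, CoSat K V α m ↔ ∀ g, Sat K V α g → K.I g m) ∨
      (∀ g, Sat K V α g ↔ ∀ m, CoSat K V α m → K.I g m) := by
  rcases isSemiconcept_extent_intent K V α with h | h
  · exact Or.inl fun m => (Set.ext_iff.1 h m).symm
  · exact Or.inr fun g => (Set.ext_iff.1 h g).symm

theorem rel_of_sat_of_coSat {K : KripkeContext G M} {V : ContextValuation K.I} {α : Formula}
    {g : G} {m : M} (hg : Sat K V α g) (hm : CoSat K V α m) : K.I g m := by
  rcases coSat_iff_or_sat_iff K V α with h | h
  · exact (h m).1 hm g hg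
  · exact (h g).1 hg m hm

theorem IsAxiom.satSequent {s : Sequent} (h : IsAxiom s) (K : KripkeContext G M)
    (V : ContextValuation K.I) : SatSequent K V s := by
  have hI := fun α g m => @rel_of_sat_of_coSat G M K V α g m
  have hC := coSat_iff_or_sat_iff K V
  cases h with
  | ax15a n =>
    have h := congrArg Semiconcept.intent (V.ov_left n)
    simp only [Semiconcept.meet, Set.inter_self] at h
    refine ⟨fun g => by simp [Sat], fun m => ?_⟩
    simp [CoSat, Sat, ← h, upperPolar]
  | ax15a' n =>
    have h := congrArg Semiconcept.intent (V.ov_left n)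
    simp only [Semiconcept.meet, Set.inter_self] at h
    refine ⟨fun g => by simp [Sat], fun m => ?_⟩
    simp [CoSat, Sat, ← h, upperPolar]
  | ax15b n =>
    have h := congrArg Semiconcept.extent (V.pv_right n)
    simp only [Semiconcept.join, Set.inter_self] at h
    refine ⟨fun g => ?_, fun m => by simp [CoSat]⟩
    simp [CoSat, Sat, ← h, lowerPolar]
  | ax15b' n =>
    have h := congrArg Semiconcept.extent (V.pv_right n)
    simp only [Semiconcept.join, Set.inter_self] at h
    refine ⟨fun g => ?_, fun m => by simp [CoSat]⟩
    simp [CoSat, Sat, ← h, lowerPolar]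
  | ax14 α =>
    -- For `A = v₁(α)` and `B = v₂(α)`, the two sides denote `(B', B'')` and `(A'', A')`. These
    -- agree because `A' = B` or `B' = A`.
    have := hI α; have := hC α
    constructor <;> simp only [Sat, CoSat] <;> grind
  | ax14' α =>
    have := hI α; have := hC α
    constructor <;> simp only [Sat, CoSat] <;> grind
  | _ =>
    constructor <;> simp only [vee, wedge, Sat, CoSat] <;> grind

theorem Provable.satHypersequent {H : Hypersequent} (h : Provable H) (K : KripkeContext G M)
    (V : ContextValuation K.I) : SatHypersequent K V H := by
  have hI := fun α g m => @rel_of_sat_of_coSat G M K V α g m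
  induction h with
  | ax h => exact ⟨_, List.mem_singleton_self _, h.satSequent K V⟩
  | sp α =>
    -- A left semiconcept satisfies the first component, a right one the second.
    rcases coSat_iff_or_sat_iff K V α with h | h
    · refine ⟨_, List.mem_cons_self, ?_⟩
      constructor <;> simp only [Sat, CoSat] <;> grind
    · refine ⟨_, List.mem_cons_of_mem _ List.mem_cons_self, ?_⟩
      constructor <;> simp only [Sat, CoSat] <;> grind
  | r4 _ _ h₁ h₂ =>
    simp only [SatHypersequent, List.mem_append, List.mem_singleton, or_and_right, exists_or,
      exists_eq_left] at *
    have : ∀ α β γ, SatSequent K V (α ⟹ₛ β) → SatSequent K V (β ⟹ₛ γ) →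
        SatSequent K V (α ⟹ₛ γ) :=
      fun α β γ h₁ h₂ => ⟨fun g h => h₂.1 g (h₁.1 g h), fun m h => h₁.2 m (h₂.2 m h)⟩
    grind
  | r5 _ _ _ _ h₁ h₂ h₃ h₄ =>
    simp only [SatHypersequent, List.mem_append, List.mem_singleton, or_and_right, exists_or,
      exists_eq_left] at *
    rename_i α β _ _ _ _
    -- The extents of the first sequent give `v₁(α) ⊆ v₁(β)`; the intents of the second give `v₂(β)
    -- ⊆ v₂(α)`.
    have hs : SatSequent K V (meet α α ⟹ₛ meet α β) →
        SatSequent K V (join α β ⟹ₛ join β β) → SatSequent K V (α ⟹ₛ β) := by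
      intro h₁ h₂
      have h₁ := h₁.1
      have h₂ := h₂.2
      simp only [Sat, CoSat] at h₁ h₂
      exact ⟨fun g h => (h₁ g ⟨h, h⟩).2, fun m h => (h₂ m ⟨h, h⟩).1⟩
    rcases h₂ with (h₂ | h₂) | h₂
    · simp only [h₂, true_or, or_true]
    · rcases h₃ with (h₃ | h₃) | h₃
      · simp only [h₃, true_or, or_true]
      · simp only [hs h₂ h₃, true_or, or_true]
      · simp only [h₃, true_or, or_true]
    · simp only [h₂, true_or, or_true]
  | ec | ee | ew =>
    simp only [SatHypersequent, List.mem_append] at *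
    grind
  | _ =>
    rename_i h
    simp only [SatHypersequent, List.mem_append, List.mem_singleton, or_and_right, exists_or,
      exists_eq_left] at *
    refine h.imp_left (Or.imp_right fun h => ?_)
    obtain ⟨h₁, h₂⟩ := h
    constructor <;> simp only [Sat, CoSat] <;> grind

end Soundness

/-! ### Modal Boolean halves -/

/-- One half of a double Boolean algebra with operators: a preorder with the operations `⊓`, `¬`,
`□` and the constants, of whose `⊔` only the upper bound property is used.  A double Boolean
algebra with operators has two such halves, and the second is the order dual of the first. -/
structure ModalHalf (A : Type u) where
  le : A → A → Prop
  meet : A → A → A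
  join : A → A → A
  neg : A → A
  top : A
  bot : A
  box : A → A
  refl : ∀ a, le a a
  trans : ∀ {a b c}, le a b → le b c → le a c
  meet_left : ∀ a b, le (meet a b) a
  meet_right : ∀ a b, le (meet a b) b
  meet_idem : ∀ a b, le (meet a b) (meet (meet a b) (meet a b))
  meet_mono : ∀ {a b c d}, le a b → le c d → le (meet a c) (meet b d)
  join_left : ∀ a b, le a (join a b)
  join_right : ∀ a b, le b (join a b)
  neg_anti : ∀ {a b}, le a b → le (neg b) (neg a)
  neg_meet_self : ∀ a, le (neg (meet a a)) (neg a)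
  neg_neg_meet : ∀ a b, le (neg (neg (meet a b))) (meet a b)
  meet_neg : ∀ a, le (meet a (neg a)) bot
  distrib : ∀ a b c, le (meet a (neg (meet (neg b) (neg c))))
    (neg (meet (neg (meet a b)) (neg (meet a c))))
  bot_le : ∀ a, le bot a
  le_top : ∀ a, le a top
  top_meet_top : le (meet top top) (neg bot)
  box_mono : ∀ {a b}, le a b → le (box a) (box b)
  meet_box : ∀ a b, le (meet (box a) (box b)) (box (meet a b))
  box_meet : ∀ a b, le (box (meet a b)) (meet (box a) (box b))
  neg_bot_le : le (neg bot) (box (neg bot))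
  box_le : ∀ a, le (box a) (box (meet a a))

namespace ModalHalf

variable {A : Type u} (L : ModalHalf A)

/-- Disjunction in the half algebra. -/
def vee (a b : A) : A := L.neg (L.meet (L.neg a) (L.neg b))

variable {L} {a b c : A}

/-- Since `a ≤ a ⊓ a` is not assumed, `⊓` is a greatest lower bound only for idempotent elements;
hence the recurring `a ⊓ a`. -/
theorem meet_self_le (hb : L.le a b) (hc : L.le a c) : L.le (L.meet a a) (L.meet b c) :=
  L.meet_mono hb hc

theorem neg_neg_le (a : A) : L.le (L.neg (L.neg a)) (L.meet a a) :=
  L.trans (L.neg_anti (L.neg_meet_self a)) (L.neg_neg_meet a a)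

theorem neg_idem (a : A) : L.le (L.neg a) (L.meet (L.neg a) (L.neg a)) :=
  L.trans (L.neg_anti (L.trans (neg_neg_le a) (L.meet_left a a))) (neg_neg_le _)

theorem box_idem (a : A) : L.le (L.box a) (L.meet (L.box a) (L.box a)) :=
  L.trans (L.box_le a) (L.box_meet a a)

/-- Contraposition: `¬a` lies below `¬b` and `¬c`, so `b ∨ c ≤ ¬¬a ≤ a ⊓ a ≤ a`. -/
theorem vee_le (hb : L.le (L.meet b b) a) (hc : L.le (L.meet c c) a) : L.le (L.vee b c) a := by
  have hb' := L.trans (L.neg_anti hb) (L.neg_meet_self b)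
  have hc' := L.trans (L.neg_anti hc) (L.neg_meet_self c)
  exact L.trans (L.trans (L.neg_anti (meet_self_le hb' hc')) (L.neg_meet_self _))
    (L.trans (neg_neg_le a) (L.meet_left a a))

/-- Excluded middle, `⊤ ⊓ ⊤ ≤ ¬⊥ ≤ b ∨ ¬b`, followed by distributivity. -/
theorem meet_self_le_vee_meet_neg (a b : A) :
    L.le (L.meet a a) (L.vee (L.meet a b) (L.meet a (L.neg b))) := by
  have h : L.le (L.meet a a) (L.vee b (L.neg b)) :=
    L.trans (L.trans (meet_self_le (L.le_top a) (L.le_top a)) L.top_meet_top)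
      (L.neg_anti (L.meet_neg _))
  exact L.trans (L.trans (L.meet_idem a a) (L.meet_mono (L.meet_left a a) h)) (L.distrib a b _)

variable (L)

/-- Filters: up-sets closed under `⊓` that contain the top element. -/
structure IsFilter (F : Set A) : Prop where
  top_mem : L.top ∈ F
  mem_of_le : ∀ {a b}, a ∈ F → L.le a b → b ∈ F
  meet_mem : ∀ {a b}, a ∈ F → b ∈ F → L.meet a b ∈ F

/-- Primary filters: proper filters that contain each element or its negation. -/
structure IsPrimary (F : Set A) : Prop extends L.IsFilter F where
  bot_notMem : L.bot ∉ F
  mem_or_neg_mem : ∀ a, a ∈ F ∨ L.neg a ∈ F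

/-- Ideals of the half algebra: down-sets closed under `∨` that contain the bottom element. -/
structure IsVeeIdeal (J : Set A) : Prop where
  bot_mem : L.bot ∈ J
  mem_of_le : ∀ {a b}, b ∈ J → L.le a b → a ∈ J
  vee_mem : ∀ {a b}, a ∈ J → b ∈ J → L.vee a b ∈ J

variable {L} {F J : Set A}

theorem IsFilter.meet_mem_iff (hF : L.IsFilter F) : L.meet a b ∈ F ↔ a ∈ F ∧ b ∈ F :=
  ⟨fun h => ⟨hF.mem_of_le h (L.meet_left a b), hF.mem_of_le h (L.meet_right a b)⟩,
    fun h => hF.meet_mem h.1 h.2⟩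

theorem IsPrimary.neg_mem_iff (hF : L.IsPrimary F) : L.neg a ∈ F ↔ a ∉ F :=
  ⟨fun h h' => hF.bot_notMem (hF.mem_of_le (hF.meet_mem h' h) (L.meet_neg a)),
    (hF.mem_or_neg_mem a).resolve_left⟩

/-- The bridge between the halves: `a ∨ b ≤ a ⊔ b`, so a filter of the dual half is an ideal of this
one. -/
theorem isVeeIdeal_of_join_mem (h₁ : L.bot ∈ J) (h₂ : ∀ {a b}, b ∈ J → L.le a b → a ∈ J)
    (h₃ : ∀ {a b}, a ∈ J → b ∈ J → L.join a b ∈ J) : L.IsVeeIdeal J :=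
  ⟨h₁, h₂, fun {a b} ha hb => h₂ (h₃ ha hb) (vee_le
    (L.trans (L.meet_left a a) (L.join_left a b)) (L.trans (L.meet_left b b) (L.join_right a b)))⟩

theorem isVeeIdeal_meet_self_le (a : A) : L.IsVeeIdeal {b | L.le (L.meet b b) a} where
  bot_mem := L.trans (L.meet_left _ _) (L.bot_le a)
  mem_of_le h h' := L.trans (L.meet_mono h' h') h
  vee_mem h h' := L.trans (L.meet_left _ _) (vee_le h h')

theorem isFilter_meet_self_le (a : A) : L.IsFilter {b | L.le (L.meet a a) b} where
  top_mem := L.le_top _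
  mem_of_le h h' := L.trans h h'
  meet_mem h h' := L.trans (L.meet_idem a a) (L.meet_mono h h')

/-- The filter generated by `F` and `a`, which tests the maximality of a filter. -/
theorem IsFilter.isFilter_insert (hF : L.IsFilter F) (a : A) :
    L.IsFilter {b | ∃ f ∈ F, L.le (L.meet f a) b} where
  top_mem := ⟨_, hF.top_mem, L.le_top _⟩
  mem_of_le := fun ⟨f, hf, h⟩ h' => ⟨f, hf, L.trans h h'⟩
  meet_mem := fun ⟨f, hf, h⟩ ⟨g, hg, h'⟩ => ⟨_, hF.meet_mem hf hg,
    L.trans (L.meet_idem _ _) (L.meet_mono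
      (L.trans (L.meet_mono (L.meet_left f g) (L.refl a)) h)
      (L.trans (L.meet_mono (L.meet_right f g) (L.refl a)) h'))⟩

/-- The prime filter theorem for a half algebra. -/
theorem IsFilter.exists_isPrimary (hF : L.IsFilter F) (hJ : L.IsVeeIdeal J)
    (hd : Disjoint F J) : ∃ P, L.IsPrimary P ∧ F ⊆ P ∧ Disjoint P J := by
  obtain ⟨P, hFP, hP⟩ := zorn_subset_nonempty {P | L.IsFilter P ∧ Disjoint P J} (by
    rintro c hc hch ⟨P₀, hP₀⟩
    refine ⟨⋃₀ c, ⟨⟨⟨P₀, hP₀, (hc hP₀).1.top_mem⟩, ?_, ?_⟩, ?_⟩,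
      fun s hs => Set.subset_sUnion_of_mem hs⟩
    · rintro a b ⟨P, hP, ha⟩ hab
      exact ⟨P, hP, (hc hP).1.mem_of_le ha hab⟩
    · rintro a b ⟨P, hP, ha⟩ ⟨Q, hQ, hb⟩
      rcases hch.total hP hQ with h | h
      · exact ⟨Q, hQ, (hc hQ).1.meet_mem (h ha) hb⟩
      · exact ⟨P, hP, (hc hP).1.meet_mem ha (h hb)⟩
    · exact Set.disjoint_sUnion_left.2 fun s hs => (hc hs).2) F ⟨hF, hd⟩
  obtain ⟨hPf, hPd⟩ := hP.prop
  have key : ∀ a, a ∉ P → ∃ f ∈ P, L.meet f a ∈ J := by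
    intro a ha
    by_contra! hcon
    have hQ := hPf.isFilter_insert a
    refine ha (hP.le_of_ge ⟨hQ, Set.disjoint_left.2 ?_⟩ (fun b hb => ⟨b, hb, L.meet_left b a⟩)
      ⟨L.top, hPf.top_mem, L.meet_right _ _⟩)
    rintro b ⟨f, hf, h⟩ hb
    exact hcon f hf (hJ.mem_of_le hb h)
  refine ⟨P, ⟨hPf, fun h => Set.disjoint_left.1 hPd h hJ.bot_mem, fun a => ?_⟩, hFP, hPd⟩
  by_contra! hcon
  obtain ⟨f, hf, hfa⟩ := key _ hcon.1
  obtain ⟨g, hg, hga⟩ := key _ hcon.2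
  -- For `e = f ⊓ g`, both `e ⊓ a` and `e ⊓ ¬a` lie in `J`, hence so does `e ⊓ e`, which is also in
  -- `P`.
  have he := hPf.meet_mem hf hg
  refine Set.disjoint_left.1 hPd (hPf.meet_mem he he) (hJ.mem_of_le (hJ.vee_mem ?_ ?_)
    (meet_self_le_vee_meet_neg _ a))
  · exact hJ.mem_of_le hfa (L.meet_mono (L.meet_left f g) (L.refl a))
  · exact hJ.mem_of_le hga (L.meet_mono (L.meet_right f g) (L.refl _))

/-- Primary filters separate: if every primary filter containing `a` contains `b`, then
`a ⊓ a ≤ b`. -/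
theorem meet_self_le_of_forall_isPrimary (h : ∀ F, L.IsPrimary F → a ∈ F → b ∈ F) :
    L.le (L.meet a a) b := by
  by_contra hab
  obtain ⟨P, hP, h₁, h₂⟩ := (isFilter_meet_self_le (L := L) a).exists_isPrimary
    (isVeeIdeal_meet_self_le b) (Set.disjoint_left.2 fun c hc hc' =>
      hab (L.trans (L.meet_idem a a) (L.trans (L.meet_mono hc hc) hc')))
  exact Set.disjoint_left.1 h₂ (h P hP (h₁ (L.meet_left a a))) (L.meet_left b b)

/-- An element that is idempotent for `⊓` and outside an ideal lies in a primary filter disjoint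
from the ideal. -/
theorem exists_isPrimary_mem_disjoint (ha : L.le a (L.meet a a)) (hJ : L.IsVeeIdeal J)
    (haJ : a ∉ J) : ∃ P, L.IsPrimary P ∧ a ∈ P ∧ Disjoint P J := by
  obtain ⟨P, hP, h₁, h₂⟩ := (isFilter_meet_self_le (L := L) a).exists_isPrimary hJ
    (Set.disjoint_left.2 fun c hc hc' => haJ (hJ.mem_of_le hc' (L.trans ha hc)))
  exact ⟨P, hP, h₁ (L.meet_left a a), h₂⟩

/-- The canonical accessibility relation computes `□`. -/
theorem IsFilter.box_mem_iff (hF : L.IsFilter F) :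
    L.box a ∈ F ↔ ∀ P, L.IsPrimary P → (∀ b, L.box b ∈ F → b ∈ P) → a ∈ P := by
  refine ⟨fun h P _ hP => hP a h, fun h => ?_⟩
  by_contra ha
  -- If `□a ∉ F`, this filter contains no `c` with `c ⊓ c ≤ a`, since `□c ≤ □(c ⊓ c) ≤ □a`. A
  -- primary extension then omits `a`.
  have hB : L.IsFilter {b | L.box b ∈ F} :=
    { top_mem := hF.mem_of_le (hF.meet_mem hF.top_mem hF.top_mem)
        (L.trans L.top_meet_top (L.trans L.neg_bot_le (L.box_mono (L.le_top _))))
      mem_of_le := fun h h' => hF.mem_of_le h (L.box_mono h')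
      meet_mem := fun h h' => hF.mem_of_le (hF.meet_mem h h') (L.meet_box _ _) }
  obtain ⟨P, hP, h₁, h₂⟩ := hB.exists_isPrimary (isVeeIdeal_meet_self_le a)
    (Set.disjoint_left.2 fun c hc hc' =>
      ha (hF.mem_of_le hc (L.trans (L.box_le c) (L.box_mono hc'))))
  exact Set.disjoint_left.1 h₂ (h P hP h₁) (L.meet_left a a)

end ModalHalf

/-! ### The canonical model -/

section Completeness

theorem Provable.trans {α β γ : Formula} (h₁ : Provable [α ⟹ₛ β]) (h₂ : Provable [β ⟹ₛ γ]) :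
    Provable [α ⟹ₛ γ] :=
  Provable.r4 (B := []) (C := []) (D := []) (E := []) h₁ h₂

/-- The formulae, preordered by provability of `α ⊢ β`, with the operations `⊓`, `¬`, `□`. -/
def objectHalf : ModalHalf Formula where
  le α β := Provable [α ⟹ₛ β]
  meet := meet
  join := join
  neg := neg
  top := top
  bot := bot
  box := box
  refl α := .ax (.ax1 α)
  trans := Provable.trans
  meet_left α β := .ax (.ax2a α β)
  meet_right α β := .ax (.ax3a α β)
  meet_idem α β := .ax (.ax4a α β)
  meet_mono h₁ h₂ := (Provable.r1 (B := []) (C := []) _ h₁).trans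
    (Provable.r1' (B := []) (C := []) _ h₂)
  join_left α β := .ax (.ax2b α β)
  join_right α β := .ax (.ax3b α β)
  neg_anti h := Provable.r3 (B := []) (C := []) h
  neg_meet_self α := .ax (.ax5a α)
  neg_neg_meet α β := .ax (.ax7a α β)
  meet_neg α := .ax (.ax6a α)
  distrib α β γ := .ax (.ax10a α β γ)
  bot_le α := .ax (.ax11a α)
  le_top α := .ax (.ax11b α)
  top_meet_top := .ax .ax13a'
  box_mono h := Provable.r8 (B := []) (C := []) h
  meet_box α β := .ax (.ax16a α β)
  box_meet α β := .ax (.ax16a' α β)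
  neg_bot_le := .ax .ax17a'
  box_le α := .ax (.ax18a' α)

/-- The formulae, preordered by provability of `β ⊢ α`, with the operations `⊔`, `⌟`, `■`. -/
def propertyHalf : ModalHalf Formula where
  le α β := Provable [β ⟹ₛ α]
  meet := join
  join := meet
  neg := opp
  top := bot
  bot := top
  box := bbox
  refl α := .ax (.ax1 α)
  trans h₁ h₂ := Provable.trans h₂ h₁
  meet_left α β := .ax (.ax2b α β)
  meet_right α β := .ax (.ax3b α β)
  meet_idem α β := .ax (.ax4b α β)
  meet_mono h₁ h₂ := (Provable.r2 (B := []) (C := []) _ h₁).trans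
    (Provable.r2' (B := []) (C := []) _ h₂)
  join_left α β := .ax (.ax2a α β)
  join_right α β := .ax (.ax3a α β)
  neg_anti h := Provable.r3' (B := []) (C := []) h
  neg_meet_self α := .ax (.ax5b α)
  neg_neg_meet α β := .ax (.ax7b' α β)
  meet_neg α := .ax (.ax6b α)
  distrib α β γ := .ax (.ax10b' α β γ)
  bot_le α := .ax (.ax11b α)
  le_top α := .ax (.ax11a α)
  top_meet_top := .ax .ax13b
  box_mono h := Provable.r9 (B := []) (C := []) h
  meet_box α β := .ax (.ax16b' α β)
  box_meet α β := .ax (.ax16b α β)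
  neg_bot_le := .ax .ax17b
  box_le α := .ax (.ax18b α)

/-- The objects of the canonical context: primary filters of formulae. -/
abbrev CanonicalObject : Type u := ULift.{u} {F : Set Formula // objectHalf.IsPrimary F}

/-- The properties of the canonical context: primary ideals of formulae. -/
abbrev CanonicalProperty : Type v := ULift.{v} {J : Set Formula // propertyHalf.IsPrimary J}

/-- The canonical Kripke context. -/
def canonicalContext : KripkeContext CanonicalObject.{u} CanonicalProperty.{v} where
  R F F₁ := ∀ α, box α ∈ F.down.1 → α ∈ F₁.down.1
  S J J₁ := ∀ α, bbox α ∈ J.down.1 → α ∈ J₁.down.1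
  I F J := (F.down.1 ∩ J.down.1).Nonempty

/-- If `α ∉ J`, idempotence gives a primary filter containing `α` and disjoint from `J`, hence not
incident with it. So `α` behaves as a left semiconcept. -/
theorem mem_ideal_iff {α : Formula} (hα : Provable [α ⟹ₛ meet α α]) (J : CanonicalProperty.{v}) :
    α ∈ J.down.1 ↔
      ∀ F : CanonicalObject.{u}, α ∈ F.down.1 → canonicalContext.I F J := by
  refine ⟨fun h F hF => ⟨α, hF, h⟩, fun h => ?_⟩
  by_contra hJ
  obtain ⟨P, hP, h₁, h₂⟩ := objectHalf.exists_isPrimary_mem_disjoint hα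
    (ModalHalf.isVeeIdeal_of_join_mem J.down.2.top_mem J.down.2.mem_of_le J.down.2.meet_mem) hJ
  exact Set.not_disjoint_iff_nonempty_inter.2 (h ⟨⟨P, hP⟩⟩ h₁) h₂

theorem mem_filter_iff {α : Formula} (hα : Provable [join α α ⟹ₛ α]) (F : CanonicalObject.{u}) :
    α ∈ F.down.1 ↔
      ∀ J : CanonicalProperty.{v}, α ∈ J.down.1 → canonicalContext.I F J := by
  refine ⟨fun h J hJ => ⟨α, h, hJ⟩, fun h => ?_⟩
  by_contra hF
  obtain ⟨P, hP, h₁, h₂⟩ := propertyHalf.exists_isPrimary_mem_disjoint hα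
    (ModalHalf.isVeeIdeal_of_join_mem F.down.2.top_mem F.down.2.mem_of_le F.down.2.meet_mem) hF
  exact Set.not_disjoint_iff_nonempty_inter.2 (h ⟨⟨P, hP⟩⟩ h₁) h₂.symm

/-- The canonical valuation. -/
def canonicalValuation : ContextValuation canonicalContext.{u, v}.I where
  ov n :=
    { extent := {F | ov n ∈ F.down.1}
      intent := {J | ov n ∈ J.down.1}
      isSemiconcept := Or.inl (Set.ext fun J => (mem_ideal_iff (.ax (.ax15a' n)) J).symm) }
  pv n :=
    { extent := {F | pv n ∈ F.down.1}
      intent := {J | pv n ∈ J.down.1}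
      isSemiconcept := Or.inr (Set.ext fun F => (mem_filter_iff (.ax (.ax15b n)) F).symm) }
  ov_left n := Semiconcept.ext (Set.inter_self _) ((congrArg (upperPolar _) (Set.inter_self _)).trans
    (Set.ext fun J => (mem_ideal_iff (.ax (.ax15a' n)) J).symm))
  pv_right n := Semiconcept.ext ((congrArg (lowerPolar _) (Set.inter_self _)).trans
    (Set.ext fun F => (mem_filter_iff (.ax (.ax15b n)) F).symm)) (Set.inter_self _)

/-- The truth lemma. -/
theorem sat_coSat_canonical (α : Formula) :
    (∀ F, Sat canonicalContext.{u, v} canonicalValuation α F ↔ α ∈ F.down.1) ∧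
      (∀ J, CoSat canonicalContext.{u, v} canonicalValuation α J ↔ α ∈ J.down.1) := by
  -- For an idempotent formula it suffices to treat one of the two satisfaction relations; the other
  -- is its polar.
  have left : ∀ {α}, Provable [α ⟹ₛ meet α α] →
      (∀ F, Sat canonicalContext.{u, v} canonicalValuation α F ↔ α ∈ F.down.1) →
      (∀ J, CoSat canonicalContext.{u, v} canonicalValuation α J ↔
        ∀ F, Sat canonicalContext.{u, v} canonicalValuation α F → canonicalContext.I F J) →
      (∀ F, Sat canonicalContext.{u, v} canonicalValuation α F ↔ α ∈ F.down.1) ∧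
      (∀ J, CoSat canonicalContext.{u, v} canonicalValuation α J ↔ α ∈ J.down.1) :=
    fun hα h h' => ⟨h, fun J => by simp only [h', h, mem_ideal_iff.{u, v} hα J]⟩
  have right : ∀ {α}, Provable [join α α ⟹ₛ α] →
      (∀ J, CoSat canonicalContext.{u, v} canonicalValuation α J ↔ α ∈ J.down.1) →
      (∀ F, Sat canonicalContext.{u, v} canonicalValuation α F ↔
        ∀ J, CoSat canonicalContext.{u, v} canonicalValuation α J → canonicalContext.I F J) →
      (∀ F, Sat canonicalContext.{u, v} canonicalValuation α F ↔ α ∈ F.down.1) ∧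
      (∀ J, CoSat canonicalContext.{u, v} canonicalValuation α J ↔ α ∈ J.down.1) :=
    fun hα h h' => ⟨fun F => by simp only [h', h, mem_filter_iff.{u, v} hα F], h⟩
  induction α with
  | ov n => exact ⟨fun F => by rw [Sat]; rfl, fun J => by rw [CoSat]; rfl⟩
  | pv n => exact ⟨fun F => by rw [Sat]; rfl, fun J => by rw [CoSat]; rfl⟩
  | top =>
    exact ⟨fun F => by simp only [Sat, true_iff]; exact F.down.2.top_mem,
      fun J => by simp only [CoSat, false_iff]; exact J.down.2.bot_notMem⟩
  | bot =>
    exact ⟨fun F => by simp only [Sat, false_iff]; exact F.down.2.bot_notMem,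
      fun J => by simp only [CoSat, true_iff]; exact J.down.2.top_mem⟩
  | meet α β hα hβ =>
    refine left (objectHalf.meet_idem α β) (fun F => ?_) fun J => by simp only [Sat, CoSat]
    simp only [Sat, hα.1, hβ.1]
    exact F.down.2.meet_mem_iff.symm
  | join α β hα hβ =>
    refine right (propertyHalf.meet_idem α β) (fun J => ?_) fun F => by simp only [Sat, CoSat]
    simp only [CoSat, hα.2, hβ.2]
    exact J.down.2.meet_mem_iff.symm
  | neg α hα =>
    refine left (objectHalf.neg_idem α) (fun F => ?_) fun J => by simp only [Sat, CoSat]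
    simp only [Sat, hα.1]
    exact F.down.2.neg_mem_iff.symm
  | opp α hα =>
    refine right (propertyHalf.neg_idem α) (fun J => ?_) fun F => by simp only [Sat, CoSat]
    simp only [CoSat, hα.2]
    exact J.down.2.neg_mem_iff.symm
  | box α hα =>
    refine left (objectHalf.box_idem α) (fun F => ?_) fun J => by simp only [Sat, CoSat]
    simp only [Sat, hα.1]
    exact Iff.trans ⟨fun h P hP hR => h ⟨⟨P, hP⟩⟩ hR, fun h F₁ => h F₁.down.1 F₁.down.2⟩
      F.down.2.box_mem_iff.symm
  | bbox α hα =>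
    refine right (propertyHalf.box_idem α) (fun J => ?_) fun F => by simp only [Sat, CoSat]
    simp only [CoSat, hα.2]
    exact Iff.trans ⟨fun h P hP hR => h ⟨⟨P, hP⟩⟩ hR, fun h J₁ => h J₁.down.1 J₁.down.2⟩
      J.down.2.box_mem_iff.symm

/-- A sequent satisfied in the canonical model is provable. -/
theorem provable_of_satSequent_canonical {s : Sequent}
    (h : SatSequent canonicalContext.{u, v} canonicalValuation s) : Provable [s] := by
  obtain ⟨α, β⟩ := s
  simp only [SatSequent, (sat_coSat_canonical _).1, (sat_coSat_canonical _).2] at h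
  have h₁ : Provable [meet α α ⟹ₛ β] := objectHalf.meet_self_le_of_forall_isPrimary
    fun F hF => h.1 ⟨⟨F, hF⟩⟩
  have h₂ : Provable [α ⟹ₛ join β β] := propertyHalf.meet_self_le_of_forall_isPrimary
    fun J hJ => h.2 ⟨⟨J, hJ⟩⟩
  refine Provable.r5 (B := []) (C := []) (D := []) (E := []) (F := []) (G := []) (H := [])
    (X := []) ?_ ?_ ?_ ?_
  · exact (objectHalf.meet_idem α β).trans (objectHalf.meet_mono
      (objectHalf.meet_left α β) (objectHalf.meet_left α β))
  · exact (objectHalf.meet_idem α α).trans (objectHalf.meet_mono (objectHalf.meet_left α α) h₁)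
  · exact propertyHalf.trans (propertyHalf.meet_idem β β)
      (propertyHalf.meet_mono h₂ (propertyHalf.meet_left β β))
  · exact propertyHalf.trans (propertyHalf.meet_idem α β) (propertyHalf.meet_mono
      (propertyHalf.meet_right α β) (propertyHalf.meet_right α β))

/-- Weakening appends the other components on the right; exchange then moves `s` past those that
precede it. -/
theorem Provable.of_mem {s : Sequent} {H : Hypersequent} (h : Provable [s]) (hs : s ∈ H) :
    Provable H := by
  obtain ⟨B, C, rfl⟩ := List.append_of_mem hs
  have h' := Provable.ee (B := []) (D := [s]) (E := B) (C := C) (by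
    simpa using Provable.ew (B ++ C) h)
  simpa using h'

end Completeness

end MPDBL

open MPDBL in
theorem mainTheorem4 :
    (∀ (G : Type u) (M : Type v) (K : KripkeContext G M) (V : ContextValuation K.I) (α : Formula),
      IsSemiconcept K.I (extent K V α) (intent K V α) ∧
      extent K V (.box α) = lowerApprox K.R (extent K V α) ∧
      intent K V (.box α) = upperPolar K.I (lowerApprox K.R (extent K V α)) ∧
      intent K V (.bbox α) = lowerApprox K.S (intent K V α) ∧
      extent K V (.bbox α) = lowerPolar K.I (lowerApprox K.S (intent K V α))) ∧
    (∀ H : Hypersequent, Provable H → Valid.{u, v} H) ∧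
    (∀ H : Hypersequent, Valid.{u, v} H → Provable H) := by
  refine ⟨fun G M K V α => ⟨isSemiconcept_extent_intent K V α, ?_, ?_, ?_, ?_⟩,
    fun H hH G M K V => hH.satHypersequent K V, fun H hH => ?_⟩
  · ext g; simp [extent, lowerApprox, Sat, Set.subset_def]
  · ext m; simp [extent, intent, lowerApprox, upperPolar, CoSat, Set.subset_def]
  · ext m; simp [intent, lowerApprox, CoSat, Set.subset_def]
  · ext g; simp [extent, intent, lowerApprox, lowerPolar, Sat, Set.subset_def]
  · obtain ⟨s, hs, h⟩ := hH _ _ canonicalContext canonicalValuation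
    exact (provable_of_satSequent_canonical h).of_mem hs
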